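/- For $m\ge 0$ and $\underline{\xi}=(\xi_1,\dots,\xi_m)\in\mathbb{R}^m$ and $\boldsymbol{q}=(q_1,\dots,q_{m+1})\in\mathbb{Z}^{m+1}$ put $L_{\underline{\xi}}(\boldsymbol{q})=q_1\xi_1+\cdots+q_m\xi_m+q_{m+1}$ and $\hat{\boldsymbol{q}}=(q_1,\dots,q_m)$, and let $\|\cdot\|$ be the maximum norm. Call $\underline{\xi}$ totally irrational if $L_{\underline{\xi}}(\boldsymbol{q})\neq 0$ for all $\boldsymbol{q}\in\mathbb{Z}^{m+1}\setminus\{\boldsymbol 0\}$. A vector $\boldsymbol{q}\in\mathbb{Z}^{m+1}$ with $\hat{\boldsymbol{q}}\neq\boldsymbol 0$ is a best approximation for $\underline{\xi}$ if $|L_{\underline{\xi}}(\boldsymbol{q})|\le|L_{\underline{\xi}}(\boldsymbol{b})|$ for all $\boldsymbol{b}\in\mathbb{Z}^{m+1}$ with $0<\|\hat{\boldsymbol{b}}\|\le\|\hat{\boldsymbol{q}}\|$. For totally irrational $\underline{\xi}$ with $m\ge1$, the best approximations are taken up to sign and ordered by increasing $\|\hat{\boldsymbol{q}}\|$, which gives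 a sequence $(\boldsymbol{q}_j)_{j\ge1}$; for such $\underline{\xi}$ let $R(\underline{\xi})$ be the least dimension of a sublattice of $\mathbb{Z}^{m+1}$ containing some tail $(\boldsymbol{q}_j)_{j\ge j_0}$. Let $\Gamma_n$ be the set of totally irrational $\underline{\xi}\in\mathbb{R}^n$ with $R(\underline{\xi})=3$. Finally let $$\hat w(\underline{\xi})=\sup\Big\{t>0:\limsup_{Q\to\infty}\min_{0<\|\hat{\boldsymbol b}\|\le Q}Q^t|L_{\underline{\xi}}(\boldsymbol b)|<\infty\Big\},\qquad \omega(\underline{\xi})=\sup\Big\{t>0:\liminf_{Q\to\infty}\min_{0<\|\hat{\boldsymbol b}\|\le Q}Q^t|L_{\underline{\xi}}(\boldsymbol b)|<\infty\Big\},$$ with values in $[0,\infty]$, where $\min\emptyset=\infty$ and $\sup\emptyset=0$ (so $\omega=0$ for the empty tuple, $m=0$). Theorem. Let $n\ge 2$ and let $\mathcal{T}_n$ be the set of all $\underline{\xi}=(\xi_1,\dots,\xi_n)\in\mathbb{R}^n$ such that $(\xi_1,\xi_2)$ is totally irrational, $\hat w(\xi_1,\xi_2)>3n-4$ and $\omega(\xi_3,\dots,\xi_n)=n-2$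 (the last condition being void for $n=2$). Then, for every $\underline{\xi}\in\mathcal{T}_n$, the infinite sequence $(\boldsymbol{q}_j)_{j\ge1}$ of best approximations for $\underline{\xi}$ exists, and some tail $(\boldsymbol{q}_j)_{j\ge j_0}$ of it lies in the three-dimensional sublattice $\langle \boldsymbol e_1,\boldsymbol e_2,\boldsymbol e_{n+1}\rangle_{\mathbb{Z}}$ of $\mathbb{Z}^{n+1}$. Moreover $\mathcal{T}_n\subseteq\Gamma_n$; in particular every $\underline{\xi}\in\mathcal{T}_n$ is totally irrational. Moreover $\hat w(\underline{\xi})=\hat w(\xi_1,\xi_2)$ and $\omega(\underline{\xi})=\omega(\xi_1,\xi_2)$ for every $\underline{\xi}\in\mathcal{T}_n$. -/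

import Mathlib

open Filter
open scoped ENNReal

namespace LinForm

/-- The restriction of an integer vector of length `n + 1` to its first `n` coordinates. -/
def hat {n : ℕ} (q : Fin (n + 1) → ℤ) : Fin n → ℤ := fun i => q i.castSucc

/-- The value `q₁ ξ₁ + ⋯ + qₙ ξₙ + qₙ₊₁` of the linear form attached to `ξ` at `q`. -/
noncomputable def form {n : ℕ} (ξ : Fin n → ℝ) (q : Fin (n + 1) → ℤ) : ℝ :=
  ∑ i : Fin n, (hat q i : ℝ) * ξ i + (q (Fin.last n) : ℝ)

/-- The linear form attached to `ξ` vanishes at no non-zero integer vector. -/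
def TotallyIrrational {n : ℕ} (ξ : Fin n → ℝ) : Prop :=
  ∀ q : Fin (n + 1) → ℤ, q ≠ 0 → form ξ q ≠ 0

/-- Best approximations: `q` has non-zero restriction `hat q`, and `|form ξ q|` is minimal among
all integer vectors `b` with `0 < ‖hat b‖ ≤ ‖hat q‖` (the norm is the maximum norm). -/
def IsBestApprox {n : ℕ} (ξ : Fin n → ℝ) (q : Fin (n + 1) → ℤ) : Prop :=
  0 < ‖hat q‖ ∧
    ∀ b : Fin (n + 1) → ℤ, 0 < ‖hat b‖ → ‖hat b‖ ≤ ‖hat q‖ → |form ξ q| ≤ |form ξ b|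

/-- `q 0, q 1, q 2, …` lists all best approximations for `ξ`, each once up to sign, in the order
of increasing norm. -/
structure IsBestApproxSeq {n : ℕ} (ξ : Fin n → ℝ) (q : ℕ → Fin (n + 1) → ℤ) : Prop where
  isBest : ∀ j, IsBestApprox ξ (q j)
  strictMono : StrictMono fun j => ‖hat (q j)‖
  exhaustive : ∀ b, IsBestApprox ξ b → ∃ j, b = q j ∨ b = -q j

/-- The sequence of best approximations for `ξ` exists and some tail of it lies in the
sublattice `L` of `ℤⁿ⁺¹`. (The sequence is unique up to signs, so its choice is immaterial.) -/
def TailLiesIn {n : ℕ} (ξ : Fin n → ℝ) (L : Submodule ℤ (Fin (n + 1) → ℤ)) : Prop :=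
  ∃ q : ℕ → Fin (n + 1) → ℤ, IsBestApproxSeq ξ q ∧ ∃ j₀ : ℕ, ∀ j ≥ j₀, q j ∈ L

/-- `R(ξ)`: the least dimension of a sublattice of `ℤⁿ⁺¹` that contains some tail of the
best approximations for `ξ`. -/
noncomputable def R {n : ℕ} (ξ : Fin n → ℝ) : ℕ :=
  sInf {r : ℕ | ∃ L : Submodule ℤ (Fin (n + 1) → ℤ), Module.finrank ℤ L = r ∧ TailLiesIn ξ L}

/-- The set `Γₙ` of all totally irrational `ξ ∈ ℝⁿ` with `R(ξ) = 3`. -/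
def Gam (n : ℕ) : Set (Fin n → ℝ) := {ξ | TotallyIrrational ξ ∧ R ξ = 3}

/-- The minimum of `|form ξ b|` over all integer vectors `b` with `0 < ‖hat b‖ ≤ Q`
(and `∞` if there is no such `b`). -/
noncomputable def minForm {n : ℕ} (ξ : Fin n → ℝ) (Q : ℝ) : ℝ≥0∞ :=
  ⨅ (b : Fin (n + 1) → ℤ) (_ : 0 < ‖hat b‖ ∧ ‖hat b‖ ≤ Q), ENNReal.ofReal |form ξ b|

/-- The uniform exponent `ŵ(ξ) ∈ [0, ∞]`. -/
noncomputable def uniformExp {n : ℕ} (ξ : Fin n → ℝ) : ℝ≥0∞ :=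
  ⨆ (t : ℝ) (_ : 0 < t ∧
    limsup (fun Q : ℝ => ENNReal.ofReal (Q ^ t) * minForm ξ Q) atTop < ∞), ENNReal.ofReal t

/-- The ordinary exponent `ω(ξ) ∈ [0, ∞]`. -/
noncomputable def ordinaryExp {n : ℕ} (ξ : Fin n → ℝ) : ℝ≥0∞ :=
  ⨆ (t : ℝ) (_ : 0 < t ∧
    liminf (fun Q : ℝ => ENNReal.ofReal (Q ^ t) * minForm ξ Q) atTop < ∞), ENNReal.ofReal t

/-- `(ξ₁, ξ₂)`. -/
def firstTwo {n : ℕ} (hn : 2 ≤ n) (ξ : Fin n → ℝ) : Fin 2 → ℝ := fun i => ξ (Fin.castLE hn i)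

/-- `(ξ₃, …, ξₙ)`. -/
def others {n : ℕ} (hn : 2 ≤ n) (ξ : Fin n → ℝ) : Fin (n - 2) → ℝ :=
  fun i => ξ ⟨(i : ℕ) + 2, by have := i.isLt; omega⟩

/-- The set `𝒯ₙ`: the product of the set of totally irrational `(ξ₁, ξ₂)` with
`ŵ(ξ₁, ξ₂) > 3n - 4` and the set of `(ξ₃, …, ξₙ)` with `ω(ξ₃, …, ξₙ) = n - 2`.
(The subtractions do not truncate, as `n ≥ 2`.) -/
def scrT {n : ℕ} (hn : 2 ≤ n) : Set (Fin n → ℝ) :=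
  {ξ | (TotallyIrrational (firstTwo hn ξ) ∧ ((3 * n - 4 : ℕ) : ℝ≥0∞) < uniformExp (firstTwo hn ξ))
    ∧ ordinaryExp (others hn ξ) = ((n - 2 : ℕ) : ℝ≥0∞)}

/-- The lattice `⟨e₁, e₂, eₙ₊₁⟩_ℤ` in `ℤⁿ⁺¹` (for `n ≥ 2`; the indices `0, 1, n` in `Fin (n + 1)`
are those of the first, second and last coordinate). -/
def lattice3 (n : ℕ) : Submodule ℤ (Fin (n + 1) → ℤ) :=
  Submodule.span ℤ {Pi.single 0 1, Pi.single 1 1, Pi.single (Fin.last n) 1}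

end LinForm

/-! Write n = m + 2, let p_j be the best approximations for (ξ₁, ξ₂), and let H be the norm of
p_{j+1}. Everything rests on `Dominates`: for large j, a vector b of norm below H with a non-zero
middle coordinate (one belonging to ξ₃, …, ξₙ) satisfies |L(b)| > |L(p_j)|; this is
`eventually_form_lt`. Suppose |L(b)| ≤ |L(p_j)|. The bound on ŵ gives |L(p_j)| ≤ H^(-T) with some T
> 3m + 2, and smallness of H·|L(p_j)| makes the minor of p_j, p_{j+1} in the first two coordinates
non-zero (`minor_ne_zero`). Hence this pair eliminates the first two coordinates of b
(`exists_elimination`), leaving a vector of norm at most 2H³ at which the form of (ξ₃, …, ξₙ) is at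
most 6H^(2-T). As ω(ξ₃, …, ξₙ) = m, that value is at least (2H³)^(-s) for any fixed s > m and large
H, a contradiction once 3s + 2 < T.

Total irrationality, the tail of the best approximations and the minimum function at large Q are
then inherited from (ξ₁, ξ₂), hence so are both exponents. For R = 3 the p_j must also leave every
sublattice of rank two (`exists_det_ne_zero`). -/

namespace LinForm

/-! ### Norms, minimizers and the sequence of best approximations -/

section Basic

variable {n : ℕ}

/-- The maximum norm of `hat q` as a natural number. -/
def height (q : Fin (n + 1) → ℤ) : ℕ := Finset.univ.sup fun i => (hat q i).natAbs

lemma norm_hat_eq (q : Fin (n + 1) → ℤ) : ‖hat q‖ = height q := by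
  apply le_antisymm
  · rw [pi_norm_le_iff_of_nonneg (by positivity)]
    intro i
    rw [Int.norm_eq_abs, ← Int.cast_abs, Int.abs_eq_natAbs, Int.cast_natCast]
    exact_mod_cast Finset.le_sup (f := fun i => (hat q i).natAbs) (Finset.mem_univ i)
  · obtain h | ⟨i, hi⟩ : height q = 0 ∨ ∃ i, height q = (hat q i).natAbs := by
      rcases isEmpty_or_nonempty (Fin n) with he | he
      · left; simp [height]
      · right
        obtain ⟨i, -, hi⟩ := Finset.exists_mem_eq_sup Finset.univ Finset.univ_nonempty
          (fun i => (hat q i).natAbs)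
        exact ⟨i, hi⟩
    · rw [h]; simp
    · rw [hi]
      refine le_trans (le_of_eq ?_) (norm_le_pi_norm (hat q) i)
      rw [Int.norm_eq_abs, ← Int.cast_abs, Int.abs_eq_natAbs, Int.cast_natCast]

lemma abs_le_norm_hat (q : Fin (n + 1) → ℤ) (i : Fin n) : |(q i.castSucc : ℝ)| ≤ ‖hat q‖ := by
  rw [← Int.norm_eq_abs]
  exact norm_le_pi_norm (hat q) i

lemma hat_neg (a : Fin (n + 1) → ℤ) : hat (-a) = -hat a := rfl

lemma form_add (ξ : Fin n → ℝ) (a b : Fin (n + 1) → ℤ) :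
    form ξ (a + b) = form ξ a + form ξ b := by
  simp only [form, hat, Pi.add_apply, Int.cast_add, add_mul, Finset.sum_add_distrib]
  ring

lemma form_smul (ξ : Fin n → ℝ) (k : ℤ) (a : Fin (n + 1) → ℤ) :
    form ξ (k • a) = k * form ξ a := by
  simp only [form, hat, Pi.smul_apply, smul_eq_mul, Int.cast_mul, mul_add, Finset.mul_sum, mul_assoc]

lemma form_neg (ξ : Fin n → ℝ) (a : Fin (n + 1) → ℤ) : form ξ (-a) = -form ξ a := by
  have := form_smul ξ (-1) a
  simpa using this

lemma form_sub (ξ : Fin n → ℝ) (a b : Fin (n + 1) → ℤ) :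
    form ξ (a - b) = form ξ a - form ξ b := by
  rw [sub_eq_add_neg, form_add, form_neg, sub_eq_add_neg]

lemma TotallyIrrational.form_pos {ξ : Fin n → ℝ} (hξ : TotallyIrrational ξ)
    {q : Fin (n + 1) → ℤ} (hq : 0 < ‖hat q‖) : 0 < |form ξ q| := by
  refine abs_pos.2 (hξ q ?_)
  rintro rfl
  have h0 : hat (0 : Fin (n + 1) → ℤ) = 0 := rfl
  simp [h0] at hq

/-- Among the integer vectors of bounded height the linear form attains its minimum. -/
lemma exists_minimizer (ξ : Fin n → ℝ) {Q : ℝ} {b₀ : Fin (n + 1) → ℤ} (h₀ : 0 < ‖hat b₀‖)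
    (hQ : ‖hat b₀‖ ≤ Q) : ∃ b, IsBestApprox ξ b ∧ ‖hat b‖ ≤ Q ∧
      ∀ c : Fin (n + 1) → ℤ, 0 < ‖hat c‖ → ‖hat c‖ ≤ Q → |form ξ b| ≤ |form ξ c| := by
  set S : Set (Fin (n + 1) → ℤ) := {b | 0 < ‖hat b‖ ∧ ‖hat b‖ ≤ Q ∧ |form ξ b| ≤ |form ξ b₀|}
    with hS
  -- `M` bounds every coordinate on `S`; the last one is the value of the form minus the sum over
  -- the others.
  set M : ℝ := Q + |form ξ b₀| + ∑ i, Q * |ξ i| with hM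
  have hQ0 : 0 ≤ Q := (norm_nonneg _).trans hQ
  have hsum : 0 ≤ ∑ i, Q * |ξ i| := Finset.sum_nonneg fun i _ => by positivity
  have hfin : S.Finite := by
    have : (Set.univ.pi fun _ : Fin (n + 1) => Set.Icc (-⌈M⌉) ⌈M⌉).Finite :=
      Set.Finite.pi fun _ => Set.finite_Icc _ _
    refine this.subset ?_
    rintro b ⟨-, hb, hf⟩ i -
    suffices h : |(b i : ℝ)| ≤ M by
      have h' := abs_le.1 h
      have h1 := Int.le_ceil M
      constructor
      · have : (-⌈M⌉ : ℝ) ≤ b i := by linarith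
        exact_mod_cast this
      · have : (b i : ℝ) ≤ ⌈M⌉ := by linarith
        exact_mod_cast this
    refine Fin.lastCases ?_ (fun i => ?_) i
    · have e : (b (Fin.last n) : ℝ) = form ξ b - ∑ i : Fin n, (hat b i : ℝ) * ξ i := by
        simp [form]
      have h2 : |∑ i : Fin n, (hat b i : ℝ) * ξ i| ≤ ∑ i, Q * |ξ i| := by
        refine (Finset.abs_sum_le_sum_abs _ _).trans (Finset.sum_le_sum fun i _ => ?_)
        rw [abs_mul]
        gcongr
        exact (abs_le_norm_hat b i).trans hb
      rw [e]
      have := abs_sub (form ξ b) (∑ i : Fin n, (hat b i : ℝ) * ξ i)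
      linarith
    · have := abs_le_norm_hat b i
      have := abs_nonneg (form ξ b₀)
      linarith
  obtain ⟨b, ⟨hb0, hbQ, hbf⟩, hmin⟩ := S.exists_min_image (fun b => |form ξ b|) hfin
    ⟨b₀, h₀, hQ, le_rfl⟩
  have key : ∀ c : Fin (n + 1) → ℤ, 0 < ‖hat c‖ → ‖hat c‖ ≤ Q → |form ξ b| ≤ |form ξ c| := by
    intro c hc hcQ
    rcases le_total |form ξ c| |form ξ b₀| with h | h
    · exact hmin c ⟨hc, hcQ, h⟩
    · exact hbf.trans h
  exact ⟨b, ⟨hb0, fun c hc hcb => key c hc (hcb.trans hbQ)⟩, hbQ, key⟩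

lemma exists_form_lt (ξ : Fin (n + 1) → ℝ) {ε : ℝ} (hε : 0 < ε) :
    ∃ b : Fin (n + 2) → ℤ, 0 < ‖hat b‖ ∧ |form ξ b| < ε := by
  obtain ⟨N, hN⟩ := exists_nat_one_div_lt hε
  -- Dirichlet's theorem for `ξ 0` alone suffices.
  obtain ⟨j, k, hk, -, h⟩ := Real.exists_int_int_abs_mul_sub_le (ξ 0) (Nat.succ_pos N)
  refine ⟨Fin.cons k (Fin.snoc 0 (-j)), ?_, ?_⟩
  · refine norm_pos_iff.2 fun h0 => ?_
    have := congrFun h0 0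
    simp [hat] at this
    omega
  · refine lt_of_le_of_lt ?_ hN
    have e : form ξ (Fin.cons k (Fin.snoc 0 (-j))) = k * ξ 0 - j := by
      have : Fin.last (n + 1) = (Fin.last n).succ := rfl
      simp [form, hat, Fin.sum_univ_succ, this, -Fin.succ_last]
      ring
    rw [e]
    refine h.trans ?_
    push_cast
    apply one_div_le_one_div_of_le <;> linarith [(Nat.cast_nonneg N : (0 : ℝ) ≤ N)]

lemma norm_hat_single (n : ℕ) : ‖hat (Pi.single 0 1 : Fin (n + 2) → ℤ)‖ = 1 := by
  have : hat (Pi.single 0 1 : Fin (n + 2) → ℤ) = Pi.single 0 1 := by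
    ext i
    refine Fin.cases ?_ (fun i => ?_) i
    · simp [hat]
    · simp [hat]
  rw [this, Pi.norm_single]
  simp

/-- The minimum up to height `N + 1` is positive, yet the form takes smaller values; a minimizer
among vectors reaching such a value must be higher. The bound `N + 1`, rather than `N`, admits the
unit vector when `N = 0`. -/
lemma exists_isBestApprox_gt {ξ : Fin (n + 1) → ℝ} (hξ : TotallyIrrational ξ) (N : ℕ) :
    ∃ b, IsBestApprox ξ b ∧ N < height b := by
  obtain ⟨b, hb, hbQ, hmin⟩ := exists_minimizer ξ (Q := N + 1) (b₀ := Pi.single 0 1)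
    (by rw [norm_hat_single]; norm_num) (by rw [norm_hat_single]; linarith [N.cast_nonneg (α := ℝ)])
  obtain ⟨c, hc, hcf⟩ := exists_form_lt ξ (hξ.form_pos hb.1)
  obtain ⟨d, hd, -, hdf⟩ := exists_minimizer ξ hc le_rfl
  refine ⟨d, hd, ?_⟩
  by_contra! h
  have := hmin d hd.1 (by rw [norm_hat_eq]; exact_mod_cast h.trans (Nat.le_succ N))
  linarith [hdf c hc le_rfl]

/-- Two best approximations of the same norm agree up to sign. -/
lemma IsBestApprox.eq_or_eq_neg {ξ : Fin n → ℝ} (hξ : TotallyIrrational ξ)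
    {a b : Fin (n + 1) → ℤ} (ha : IsBestApprox ξ a) (hb : IsBestApprox ξ b)
    (h : ‖hat a‖ = ‖hat b‖) : a = b ∨ a = -b := by
  have e : |form ξ a| = |form ξ b| := le_antisymm (ha.2 b hb.1 h.ge) (hb.2 a ha.1 h.le)
  rcases abs_eq_abs.1 e with e | e
  · left
    by_contra hne
    exact hξ (a - b) (sub_ne_zero.2 hne) (by rw [form_sub, e, sub_self])
  · right
    by_contra hne
    refine hξ (a + b) (fun h0 => hne (eq_neg_of_add_eq_zero_left h0)) (by rw [form_add, e]; ring)

/-- The sequence of best approximations of a totally irrational tuple exists. -/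
theorem exists_isBestApproxSeq {ξ : Fin (n + 1) → ℝ} (hξ : TotallyIrrational ξ) :
    ∃ q, IsBestApproxSeq ξ q := by
  set P : ℕ → Prop := fun h => ∃ b, IsBestApprox ξ b ∧ height b = h with hP
  have hinf : {h | P h}.Infinite := by
    refine Set.infinite_of_not_bddAbove ?_
    rintro ⟨N, hN⟩
    obtain ⟨b, hb, hbN⟩ := exists_isBestApprox_gt hξ N
    exact absurd (hN ⟨b, hb, rfl⟩) (by simpa using hbN)
  choose q hq hqh using fun j => Nat.nth_mem_of_infinite hinf j
  refine ⟨q, hq, ?_, ?_⟩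
  · intro i j hij
    simp only [norm_hat_eq, hqh]
    exact_mod_cast Nat.nth_strictMono hinf hij
  · intro b hb
    have : height b ∈ Set.range (Nat.nth P) := by
      rw [Nat.range_nth_of_infinite hinf]
      exact ⟨b, hb, rfl⟩
    obtain ⟨j, hj⟩ := this
    refine ⟨j, hb.eq_or_eq_neg hξ (hq j) ?_⟩
    rw [norm_hat_eq, norm_hat_eq, hqh, hj]

namespace IsBestApproxSeq

variable {ξ : Fin n → ℝ} {q : ℕ → Fin (n + 1) → ℤ}

lemma tendsto (h : IsBestApproxSeq ξ q) : Tendsto (fun j => ‖hat (q j)‖) atTop atTop := by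
  have : StrictMono fun j => height (q j) := by
    intro i j hij
    have := h.strictMono hij
    simp only [norm_hat_eq] at this
    exact_mod_cast this
  simp only [norm_hat_eq]
  exact tendsto_natCast_atTop_atTop.comp this.tendsto_atTop

/-- Below the norm of `q (j + 1)` the linear form is at least as large as at `q j`. -/
lemma le_of_lt (h : IsBestApproxSeq ξ q) {j : ℕ} {c : Fin (n + 1) → ℤ} (hc : 0 < ‖hat c‖)
    (hcj : ‖hat c‖ < ‖hat (q (j + 1))‖) : |form ξ (q j)| ≤ |form ξ c| := by
  obtain ⟨b, hb, hbc, hmin⟩ := exists_minimizer ξ hc le_rfl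
  obtain ⟨k, hk⟩ := h.exhaustive b hb
  have e1 : ‖hat b‖ = ‖hat (q k)‖ := by rcases hk with rfl | rfl <;> simp [hat_neg]
  have e2 : |form ξ b| = |form ξ (q k)| := by rcases hk with rfl | rfl <;> simp [form_neg]
  have hkj : k < j + 1 := h.strictMono.lt_iff_lt.1 (by
    show ‖hat (q k)‖ < ‖hat (q (j + 1))‖
    linarith)
  refine le_trans ?_ (hmin c hc le_rfl)
  rw [e2]
  exact (h.isBest j).2 _ (h.isBest k).1 (h.strictMono.monotone (Nat.lt_succ_iff.1 hkj))

lemma form_succ_le (h : IsBestApproxSeq ξ q) (j : ℕ) :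
    |form ξ (q (j + 1))| ≤ |form ξ (q j)| :=
  (h.isBest (j + 1)).2 _ (h.isBest j).1 (h.strictMono.monotone (Nat.le_succ j))

lemma exists_between (h : IsBestApproxSeq ξ q) {j₀ : ℕ} {x : ℝ} (hx : ‖hat (q j₀)‖ ≤ x) :
    ∃ j ≥ j₀, ‖hat (q j)‖ ≤ x ∧ x < ‖hat (q (j + 1))‖ := by
  classical
  have hex : ∃ j, x < ‖hat (q j)‖ := (h.tendsto.eventually_gt_atTop x).exists
  have hs := Nat.find_spec hex
  have hlt : j₀ < Nat.find hex := h.strictMono.lt_iff_lt.1 (lt_of_le_of_lt hx hs)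
  obtain ⟨k, hk⟩ : ∃ k, Nat.find hex = k + 1 := ⟨Nat.find hex - 1, by omega⟩
  refine ⟨k, by omega, not_lt.1 (Nat.find_min hex (by omega)), ?_⟩
  rw [← hk]
  exact hs

end IsBestApproxSeq

end Basic

/-! ### Exponents turned into inequalities -/

section Exponents

variable {n : ℕ}

lemma minForm_le (ξ : Fin n → ℝ) {Q : ℝ} {b : Fin (n + 1) → ℤ} (hb : 0 < ‖hat b‖)
    (hbQ : ‖hat b‖ ≤ Q) : minForm ξ Q ≤ ENNReal.ofReal |form ξ b| :=
  iInf₂_le b ⟨hb, hbQ⟩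

/-- A real number below the uniform exponent is an exponent of uniform approximation. -/
lemma eventually_exists_of_lt_uniformExp {ξ : Fin n → ℝ} {T : ℝ}
    (h : ENNReal.ofReal T < uniformExp ξ) :
    ∀ᶠ Q : ℝ in atTop, ∃ c : Fin (n + 1) → ℤ,
      0 < ‖hat c‖ ∧ ‖hat c‖ < Q ∧ |form ξ c| ≤ Q ^ (-T) := by
  obtain ⟨t, ht⟩ := lt_iSup_iff.1 h
  obtain ⟨⟨ht0, hlim⟩, htT⟩ := lt_iSup_iff.1 ht
  have hTt : T < t := (ENNReal.ofReal_lt_ofReal_iff ht0).1 htT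
  obtain ⟨C, hC1, hC2⟩ := ENNReal.lt_iff_exists_nnreal_btwn.1 hlim
  have hev := eventually_lt_of_limsup_lt hC1
  -- Working at `Q / 2` makes the norm bound strict, as `le_of_lt` requires; the gap between `T` and
  -- `t` absorbs the factor `C * 2 ^ t`.
  have hhalf : Tendsto (fun Q : ℝ => Q / 2) atTop atTop :=
    tendsto_id.atTop_div_const (by norm_num)
  have hbig : Tendsto (fun Q : ℝ => Q ^ (t - T)) atTop atTop :=
    tendsto_rpow_atTop (by linarith)
  filter_upwards [hhalf.eventually hev, eventually_gt_atTop 0,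
    hbig.eventually_ge_atTop (C * 2 ^ t)] with Q hQ hQ0 hQb
  have hQ2 : 0 < Q / 2 := by linarith
  have hp : 0 < (Q / 2) ^ t := Real.rpow_pos_of_pos hQ2 t
  have hm : minForm ξ (Q / 2) < ENNReal.ofReal (C * (Q / 2) ^ (-t)) := by
    rw [Real.rpow_neg hQ2.le, ← div_eq_mul_inv, ENNReal.ofReal_div_of_pos hp,
      ENNReal.ofReal_coe_nnreal]
    rw [ENNReal.lt_div_iff_mul_lt (Or.inl (ENNReal.ofReal_pos.2 hp).ne') (by simp), mul_comm]
    exact hQ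
  obtain ⟨c, hc⟩ := iInf_lt_iff.1 hm
  obtain ⟨⟨hc0, hcQ⟩, hcf⟩ := iInf_lt_iff.1 hc
  refine ⟨c, hc0, by linarith, ?_⟩
  have hlt := (ENNReal.ofReal_lt_ofReal_iff_of_nonneg (abs_nonneg _)).1 hcf
  refine hlt.le.trans ?_
  rw [Real.rpow_neg hQ2.le, Real.rpow_neg hQ0.le, ← div_eq_mul_inv, Real.div_rpow hQ0.le (by norm_num)]
  have h2 : (0 : ℝ) < 2 ^ t := by positivity
  have hQt : 0 < Q ^ t := Real.rpow_pos_of_pos hQ0 t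
  have hQT : 0 < Q ^ T := Real.rpow_pos_of_pos hQ0 T
  rw [Real.rpow_sub hQ0] at hQb
  rw [le_div_iff₀ hQT] at hQb
  rw [div_div_eq_mul_div, div_le_iff₀ hQt, ← div_eq_inv_mul, le_div_iff₀ hQT]
  exact hQb

/-- A real number above the ordinary exponent gives a lower bound for the linear form. -/
lemma eventually_le_form_of_ordinaryExp_lt {ξ : Fin n → ℝ} {s : ℝ} (hs : 0 < s)
    (h : ordinaryExp ξ < ENNReal.ofReal s) :
    ∀ᶠ Q : ℝ in atTop, ∀ c : Fin (n + 1) → ℤ,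
      0 < ‖hat c‖ → ‖hat c‖ ≤ Q → Q ^ (-s) ≤ |form ξ c| := by
  have hnot : ¬ liminf (fun Q : ℝ => ENNReal.ofReal (Q ^ s) * minForm ξ Q) atTop < ∞ := by
    intro hl
    refine absurd h (not_lt.2 ?_)
    exact le_iSup_of_le s (le_iSup_of_le ⟨hs, hl⟩ le_rfl)
  have h1 : (1 : ℝ≥0∞) < liminf (fun Q : ℝ => ENNReal.ofReal (Q ^ s) * minForm ξ Q) atTop := by
    rw [not_lt_top_iff.1 hnot]
    exact ENNReal.one_lt_top
  filter_upwards [eventually_lt_of_lt_liminf h1, eventually_gt_atTop 0] with Q hQ hQ0 c hc hcQ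
  have hp : 0 < Q ^ s := Real.rpow_pos_of_pos hQ0 s
  have hm : minForm ξ Q ≤ ENNReal.ofReal |form ξ c| := minForm_le ξ hc hcQ
  have h2 : 1 < ENNReal.ofReal (Q ^ s * |form ξ c|) := by
    rw [ENNReal.ofReal_mul hp.le]
    exact lt_of_lt_of_le hQ (by gcongr)
  rw [← ENNReal.ofReal_one, ENNReal.ofReal_lt_ofReal_iff_of_nonneg zero_le_one] at h2
  rw [Real.rpow_neg hQ0.le, inv_eq_one_div, div_le_iff₀ hp, mul_comm]
  exact h2.le

/-- Consecutive best approximations: the linear form at `q j` is small in terms of `q (j + 1)`. -/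
lemma IsBestApproxSeq.eventually_form_le {ξ : Fin n → ℝ} {q : ℕ → Fin (n + 1) → ℤ}
    (hq : IsBestApproxSeq ξ q) {T : ℝ} (h : ENNReal.ofReal T < uniformExp ξ) :
    ∀ᶠ j in atTop, |form ξ (q j)| ≤ ‖hat (q (j + 1))‖ ^ (-T) := by
  have := (hq.tendsto.comp (tendsto_add_atTop_nat 1)).eventually
    (eventually_exists_of_lt_uniformExp h)
  filter_upwards [this] with j hj
  obtain ⟨c, hc, hcQ, hcf⟩ := hj
  exact (hq.le_of_lt hc hcQ).trans hcf

lemma uniformExp_congr {k : ℕ} {ξ : Fin n → ℝ} {η : Fin k → ℝ}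
    (h : minForm ξ =ᶠ[atTop] minForm η) : uniformExp ξ = uniformExp η := by
  have (t : ℝ) : limsup (fun Q : ℝ => ENNReal.ofReal (Q ^ t) * minForm ξ Q) atTop =
      limsup (fun Q : ℝ => ENNReal.ofReal (Q ^ t) * minForm η Q) atTop :=
    limsup_congr (h.mono fun Q hQ => by rw [hQ])
  simp only [uniformExp, this]

lemma ordinaryExp_congr {k : ℕ} {ξ : Fin n → ℝ} {η : Fin k → ℝ}
    (h : minForm ξ =ᶠ[atTop] minForm η) : ordinaryExp ξ = ordinaryExp η := by
  have (t : ℝ) : liminf (fun Q : ℝ => ENNReal.ofReal (Q ^ t) * minForm ξ Q) atTop =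
      liminf (fun Q : ℝ => ENNReal.ofReal (Q ^ t) * minForm η Q) atTop :=
    liminf_congr (h.mono fun Q hQ => by rw [hQ])
  simp only [ordinaryExp, this]

end Exponents

/-! ### Best approximations in two variables -/

section Planar

/-- The minor of `x` and `y` in the first two coordinates. -/
def minor (x y : Fin 3 → ℤ) : ℤ := x 0 * y 1 - x 1 * y 0

lemma abs_zero_le (x : Fin 3 → ℤ) : |(x 0 : ℝ)| ≤ ‖hat x‖ := abs_le_norm_hat x 0
lemma abs_one_le (x : Fin 3 → ℤ) : |(x 1 : ℝ)| ≤ ‖hat x‖ := abs_le_norm_hat x 1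

lemma abs_mul_sub_mul_le {a b c d X Y : ℝ} (ha : |a| ≤ X) (hb : |b| ≤ X) (hc : |c| ≤ Y)
    (hd : |d| ≤ Y) : |a * d - b * c| ≤ 2 * X * Y := by
  have h1 : |a * d| ≤ X * Y := by
    rw [abs_mul]; exact mul_le_mul ha hd (abs_nonneg _) ((abs_nonneg _).trans ha)
  have h2 : |b * c| ≤ X * Y := by
    rw [abs_mul]; exact mul_le_mul hb hc (abs_nonneg _) ((abs_nonneg _).trans ha)
  have := abs_sub (a * d) (b * c)
  linarith

lemma abs_minor_le (x y : Fin 3 → ℤ) : |(minor x y : ℝ)| ≤ 2 * ‖hat x‖ * ‖hat y‖ := by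
  simp only [minor]
  push_cast
  exact abs_mul_sub_mul_le (abs_zero_le x) (abs_one_le x) (abs_zero_le y) (abs_one_le y)

lemma form_three (η : Fin 2 → ℝ) (x : Fin 3 → ℤ) :
    form η x = x 0 * η 0 + x 1 * η 1 + x 2 := by
  simp [form, hat, Fin.sum_univ_two]

lemma norm_hat_three (x : Fin 3 → ℤ) : ‖hat x‖ = max |(x 0 : ℝ)| |(x 1 : ℝ)| := by
  apply le_antisymm
  · rw [pi_norm_le_iff_of_nonneg (le_max_of_le_left (abs_nonneg _))]
    intro i
    rw [Int.norm_eq_abs]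
    fin_cases i
    · exact le_max_left _ _
    · exact le_max_right _ _
  · exact max_le (abs_zero_le x) (abs_one_le x)

/-- Two vectors of increasing norms along which the linear form is small and does not increase
have a non-zero minor. -/
lemma minor_ne_zero {η : Fin 2 → ℝ} {x y : Fin 3 → ℤ} (hx : 0 < ‖hat x‖)
    (hxy : ‖hat x‖ < ‖hat y‖) (hf : 0 < |form η x|) (hle : |form η y| ≤ |form η x|)
    (hsmall : 2 * ‖hat y‖ * |form η x| < 1) : minor x y ≠ 0 := by
  intro hD
  have hDr : (x 0 : ℝ) * y 1 = x 1 * y 0 := by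
    have : x 0 * y 1 = x 1 * y 0 := sub_eq_zero.1 hD
    exact_mod_cast this
  -- With parallel first two coordinates, the integer `x i * y 2 - y i * x 2` has absolute value
  -- below 1, so it vanishes and `x`, `y` are proportional. The larger norm of `y` would then force
  -- a larger value of the form.
  have main : ∀ i : Fin 3, x i ≠ 0 → |(x i : ℝ)| ≤ ‖hat x‖ → |(y i : ℝ)| ≤ ‖hat y‖ →
      ((x i : ℝ) * y 0 = y i * x 0) → ((x i : ℝ) * y 1 = y i * x 1) → False := by
    intro i hi hxi hyi h0 h1
    have e : ((x i * y 2 - y i * x 2 : ℤ) : ℝ) = x i * form η y - y i * form η x := by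
      rw [form_three, form_three]
      push_cast
      linear_combination -η 0 * h0 - η 1 * h1
    have hN : x i * y 2 - y i * x 2 = 0 := by
      rw [← Int.abs_lt_one_iff]
      have : |((x i * y 2 - y i * x 2 : ℤ) : ℝ)| < 1 := by
        rw [e]
        refine lt_of_le_of_lt (abs_sub _ _) ?_
        rw [abs_mul, abs_mul]
        have a1 : |(x i : ℝ)| * |form η y| ≤ ‖hat y‖ * |form η x| :=
          mul_le_mul (hxi.trans hxy.le) hle (abs_nonneg _) (norm_nonneg _)
        have a2 : |(y i : ℝ)| * |form η x| ≤ ‖hat y‖ * |form η x| :=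
          mul_le_mul_of_nonneg_right hyi (abs_nonneg _)
        linarith
      exact_mod_cast this
    rw [hN, Int.cast_zero] at e
    have e' : |(x i : ℝ)| * |form η y| = |(y i : ℝ)| * |form η x| := by
      rw [← abs_mul, ← abs_mul, sub_eq_zero.1 e.symm]
    have hn : |(x i : ℝ)| * ‖hat y‖ = |(y i : ℝ)| * ‖hat x‖ := by
      rw [norm_hat_three, norm_hat_three, mul_max_of_nonneg _ _ (abs_nonneg _),
        mul_max_of_nonneg _ _ (abs_nonneg _), ← abs_mul, ← abs_mul, ← abs_mul, ← abs_mul, h0, h1]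
    have hxi0 : 0 < |(x i : ℝ)| := abs_pos.2 (by exact_mod_cast hi)
    have hlt : |(x i : ℝ)| < |(y i : ℝ)| := by
      by_contra! hge
      have := mul_le_mul_of_nonneg_right hge hx.le
      have := mul_lt_mul_of_pos_left hxy hxi0
      linarith
    have := mul_lt_mul_of_pos_right hlt hf
    have := mul_le_mul_of_nonneg_left hle hxi0.le
    linarith
  by_cases hx0 : x 0 = 0
  · have hx1 : x 1 ≠ 0 := by
      intro hx1
      rw [norm_hat_three, hx0, hx1] at hx
      simp at hx
    exact main 1 hx1 (abs_one_le x) (abs_one_le y) (by linarith) (by ring)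
  · exact main 0 hx0 (abs_zero_le x) (abs_zero_le y) (by ring) (by linarith)

lemma IsBestApproxSeq.tendsto_mul_form {η : Fin 2 → ℝ} {p : ℕ → Fin 3 → ℤ}
    (hp : IsBestApproxSeq η p) (h : 2 < uniformExp η) :
    Tendsto (fun j => ‖hat (p (j + 1))‖ * |form η (p j)|) atTop (nhds 0) := by
  have hH := hp.tendsto.comp (tendsto_add_atTop_nat 1)
  have h2 := hp.eventually_form_le (T := 2) (by simpa using h)
  have hinv : Tendsto (fun j => ‖hat (p (j + 1))‖⁻¹) atTop (nhds 0) :=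
    tendsto_inv_atTop_zero.comp hH
  refine squeeze_zero' (Eventually.of_forall fun j => by positivity) ?_ hinv
  filter_upwards [h2, hH.eventually_gt_atTop 0] with j hj hj0
  simp only [Function.comp_apply] at hj0
  rw [Real.rpow_neg hj0.le, Real.rpow_ofNat] at hj
  calc ‖hat (p (j + 1))‖ * |form η (p j)|
      ≤ ‖hat (p (j + 1))‖ * (‖hat (p (j + 1))‖ ^ 2)⁻¹ := by gcongr
    _ = ‖hat (p (j + 1))‖⁻¹ := by field_simp

lemma IsBestApproxSeq.eventually_minor_ne_zero {η : Fin 2 → ℝ} {p : ℕ → Fin 3 → ℤ}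
    (hη : TotallyIrrational η) (hp : IsBestApproxSeq η p) (h : 2 < uniformExp η) :
    ∀ᶠ j in atTop, minor (p j) (p (j + 1)) ≠ 0 := by
  filter_upwards [(hp.tendsto_mul_form h).eventually_lt_const (by norm_num : (0 : ℝ) < 1 / 2)]
    with j hj
  exact minor_ne_zero (hp.isBest j).1 (hp.strictMono (Nat.lt_succ_self j))
    (hη.form_pos (hp.isBest j).1) (hp.form_succ_le j) (by linarith)

/-- The best approximations do not eventually lie in a sublattice of rank two. -/
lemma IsBestApproxSeq.exists_det_ne_zero {η : Fin 2 → ℝ} {p : ℕ → Fin 3 → ℤ}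
    (hη : TotallyIrrational η) (hp : IsBestApproxSeq η p) (h : 2 < uniformExp η) (a : ℕ) :
    ∃ j ≥ a, Matrix.det !![p a 0, p a 1, p a 2; p j 0, p j 1, p j 2;
      p (j + 1) 0, p (j + 1) 1, p (j + 1) 2] ≠ 0 := by
  -- The factor 4 comes from two minors, each at most `2 * ‖hat (p a)‖ * ‖hat (p (j + 1))‖`.
  have hlim : Tendsto (fun j => 4 * ‖hat (p a)‖ * (‖hat (p (j + 1))‖ * |form η (p j)|)) atTop
      (nhds 0) := by
    simpa using (hp.tendsto_mul_form h).const_mul (4 * ‖hat (p a)‖)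
  obtain ⟨j, hj, hjm, hja⟩ := ((hlim.eventually_lt_const (hη.form_pos (hp.isBest a).1)).and
    ((hp.eventually_minor_ne_zero hη h).and (eventually_ge_atTop a))).exists
  refine ⟨j, hja, fun hdet => ?_⟩
  rw [Matrix.det_fin_three] at hdet
  simp only [Matrix.of_apply, Matrix.cons_val', Matrix.cons_val_zero, Matrix.cons_val_one,
    Matrix.cons_val] at hdet
  have hdet' := congrArg (Int.cast : ℤ → ℝ) hdet
  push_cast at hdet'
  -- Column operations put the values of the form into the third column; this expands the vanishing
  -- determinant along it.
  have e : form η (p a) * minor (p j) (p (j + 1)) =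
      form η (p j) * minor (p a) (p (j + 1)) - form η (p (j + 1)) * minor (p a) (p j) := by
    simp only [form_three, minor]
    push_cast
    linear_combination hdet'
  have h1 : 1 ≤ |(minor (p j) (p (j + 1)) : ℝ)| := by
    exact_mod_cast Int.one_le_abs hjm
  have h2 : |form η (p a)| ≤ |form η (p a) * minor (p j) (p (j + 1))| := by
    rw [abs_mul]
    exact le_mul_of_one_le_right (abs_nonneg _) h1
  rw [e] at h2
  have h3 := abs_sub (form η (p j) * minor (p a) (p (j + 1)))
    (form η (p (j + 1)) * minor (p a) (p j))
  rw [abs_mul, abs_mul] at h3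
  have h4 : |form η (p j)| * |(minor (p a) (p (j + 1)) : ℝ)| ≤
      |form η (p j)| * (2 * ‖hat (p a)‖ * ‖hat (p (j + 1))‖) :=
    mul_le_mul_of_nonneg_left (abs_minor_le _ _) (abs_nonneg _)
  have h5 : |form η (p (j + 1))| * |(minor (p a) (p j) : ℝ)| ≤
      |form η (p j)| * (2 * ‖hat (p a)‖ * ‖hat (p (j + 1))‖) := by
    refine mul_le_mul (hp.form_succ_le j) ((abs_minor_le _ _).trans ?_) (abs_nonneg _)
      (abs_nonneg _)
    have := (hp.strictMono (Nat.lt_succ_self j)).le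
    exact mul_le_mul_of_nonneg_left this (by positivity)
  linarith

end Planar

/-! ### Eliminating the first two coordinates -/

section Extension

variable {m : ℕ}

/-- The inclusion of `ℤ³` into `ℤᵐ⁺³` as the first two and the last coordinates. -/
def emb (m : ℕ) : (Fin 3 → ℤ) →ₗ[ℤ] (Fin (m + 3) → ℤ) where
  toFun p := Fin.cons (p 0) (Fin.cons (p 1) (Fin.snoc (α := fun _ => ℤ) (0 : Fin m → ℤ) (p 2)))
  map_add' x y := by
    ext i
    refine Fin.cases rfl (fun i => Fin.cases rfl (fun i => ?_) i) i
    refine Fin.lastCases ?_ (fun i => ?_) i <;> simp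
  map_smul' k x := by
    ext i
    refine Fin.cases rfl (fun i => Fin.cases rfl (fun i => ?_) i) i
    refine Fin.lastCases ?_ (fun i => ?_) i <;> simp

/-- The vector without its first two coordinates. -/
def rest (b : Fin (m + 3) → ℤ) : Fin (m + 1) → ℤ := fun i => b i.succ.succ

@[simp] lemma emb_zero (p : Fin 3 → ℤ) : emb m p 0 = p 0 := rfl
@[simp] lemma emb_one (p : Fin 3 → ℤ) : emb m p 1 = p 1 := rfl
@[simp] lemma hat_rest_emb (p : Fin 3 → ℤ) : hat (rest (emb m p)) = 0 := by
  ext i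
  simp [hat, rest, emb]
@[simp] lemma rest_emb_last (p : Fin 3 → ℤ) : rest (emb m p) (Fin.last m) = p 2 := by
  simp [rest, emb, -Fin.succ_last]
@[simp] lemma emb_last (p : Fin 3 → ℤ) : emb m p (Fin.last (m + 2)) = p 2 := rest_emb_last p

lemma emb_injective : Function.Injective (emb m) := by
  intro x y h
  ext i
  fin_cases i
  · simpa using congrFun h 0
  · simpa using congrFun h 1
  · simpa using congrFun h (Fin.last (m + 2))

lemma emb_eq_of_hat_rest {b : Fin (m + 3) → ℤ} (h : hat (rest b) = 0) :
    emb m ![b 0, b 1, b (Fin.last (m + 2))] = b := by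
  ext i
  refine Fin.cases rfl (fun i => Fin.cases rfl (fun i => ?_) i) i
  refine Fin.lastCases ?_ (fun i => ?_) i
  · exact emb_last _
  · exact (congrFun (hat_rest_emb ![b 0, b 1, b (Fin.last (m + 2))]) i).trans (congrFun h i).symm

lemma norm_hat_emb (p : Fin 3 → ℤ) : ‖hat (emb m p)‖ = ‖hat p‖ := by
  rw [norm_hat_three]
  apply le_antisymm
  · rw [pi_norm_le_iff_of_nonneg (le_max_of_le_left (abs_nonneg _))]
    intro i
    rw [Int.norm_eq_abs]
    refine Fin.cases (le_max_left _ _) (fun i => Fin.cases (le_max_right _ _) (fun i => ?_) i) i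
    have : hat (emb m p) i.succ.succ = 0 := congrFun (hat_rest_emb p) i
    rw [this, Int.cast_zero, abs_zero]
    exact le_max_of_le_left (abs_nonneg _)
  · exact max_le (abs_le_norm_hat (emb m p) 0) (abs_le_norm_hat (emb m p) 1)

lemma norm_hat_rest_le (b : Fin (m + 3) → ℤ) : ‖hat (rest b)‖ ≤ ‖hat b‖ := by
  rw [pi_norm_le_iff_of_nonneg (norm_nonneg _)]
  intro i
  exact norm_le_pi_norm (hat b) i.succ.succ

lemma form_eq_rest (ξ : Fin (m + 2) → ℝ) (b : Fin (m + 3) → ℤ) :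
    form ξ b = b 0 * ξ 0 + b 1 * ξ 1 + form (fun i => ξ i.succ.succ) (rest b) := by
  simp only [form, Fin.sum_univ_succ (n := m + 1), Fin.sum_univ_succ (n := m), add_assoc]
  rfl

lemma form_emb (ξ : Fin (m + 2) → ℝ) (p : Fin 3 → ℤ) :
    form ξ (emb m p) = form ![ξ 0, ξ 1] p := by
  rw [form_eq_rest, form_three]
  simp only [form, hat_rest_emb, rest_emb_last]
  simp

/-- Elimination of the first two coordinates. -/
lemma exists_elimination (ξ : Fin (m + 2) → ℝ) {x y : Fin 3 → ℤ} (b : Fin (m + 3) → ℤ)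
    (hxy : minor x y ≠ 0) (hb : hat (rest b) ≠ 0) {H δ : ℝ} (hx : ‖hat x‖ ≤ H) (hy : ‖hat y‖ ≤ H)
    (hbH : ‖hat b‖ ≤ H) (hxδ : |form ![ξ 0, ξ 1] x| ≤ δ) (hyδ : |form ![ξ 0, ξ 1] y| ≤ δ)
    (hbδ : |form ξ b| ≤ δ) :
    ∃ c : Fin (m + 1) → ℤ, 0 < ‖hat c‖ ∧ ‖hat c‖ ≤ 2 * H ^ 3 ∧
      |form (fun i => ξ i.succ.succ) c| ≤ 6 * H ^ 2 * δ := by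
  have hH : 0 ≤ H := (norm_nonneg _).trans hx
  have hδ : 0 ≤ δ := (abs_nonneg _).trans hxδ
  -- Cramer's rule: with these coefficients the first two coordinates of `c` cancel, while its
  -- middle ones are those of `b` times the minor.
  set α : ℤ := b 0 * y 1 - b 1 * y 0 with hα
  set β : ℤ := x 0 * b 1 - x 1 * b 0 with hβ
  set c : Fin (m + 3) → ℤ := minor x y • b - α • emb m x - β • emb m y with hc
  have hhat : hat (rest c) = minor x y • hat (rest b) := by
    have e : hat (rest c) = minor x y • hat (rest b) - α • hat (rest (emb m x))
      - β • hat (rest (emb m y)) := rfl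
    rw [e]; simp
  have hform : form (fun i => ξ i.succ.succ) (rest c) = form ξ c := by
    have h0 : c 0 = 0 := by
      simp only [hc, hα, hβ, minor, Pi.sub_apply, Pi.smul_apply, emb_zero, smul_eq_mul]; ring
    have h1 : c 1 = 0 := by
      simp only [hc, hα, hβ, minor, Pi.sub_apply, Pi.smul_apply, emb_one, smul_eq_mul]; ring
    rw [form_eq_rest ξ c, h0, h1]
    simp
  have hb0 : |(b 0 : ℝ)| ≤ H := (abs_le_norm_hat b 0).trans hbH
  have hb1 : |(b 1 : ℝ)| ≤ H := (abs_le_norm_hat b 1).trans hbH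
  have hx0 := (abs_zero_le x).trans hx
  have hx1 := (abs_one_le x).trans hx
  have hy0 := (abs_zero_le y).trans hy
  have hy1 := (abs_one_le y).trans hy
  have hDle : |(minor x y : ℝ)| ≤ 2 * H * H := by
    simp only [minor]; push_cast; exact abs_mul_sub_mul_le hx0 hx1 hy0 hy1
  have hαle : |(α : ℝ)| ≤ 2 * H * H := by
    simp only [hα]; push_cast; exact abs_mul_sub_mul_le hb0 hb1 hy0 hy1
  have hβle : |(β : ℝ)| ≤ 2 * H * H := by
    simp only [hβ]; push_cast; exact abs_mul_sub_mul_le hx0 hx1 hb0 hb1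
  refine ⟨rest c, ?_, ?_, ?_⟩
  · rw [hhat, norm_pos_iff]
    exact smul_ne_zero hxy hb
  · rw [hhat, norm_smul, Int.norm_eq_abs]
    calc |(minor x y : ℝ)| * ‖hat (rest b)‖ ≤ 2 * H * H * H :=
          mul_le_mul hDle ((norm_hat_rest_le b).trans hbH) (norm_nonneg _) (by positivity)
      _ = 2 * H ^ 3 := by ring
  · rw [hform, hc, form_sub, form_sub, form_smul, form_smul, form_smul, form_emb, form_emb]
    have t1 : |(minor x y : ℝ) * form ξ b| ≤ 2 * H * H * δ := by
      rw [abs_mul]; exact mul_le_mul hDle hbδ (abs_nonneg _) (by positivity)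
    have t2 : |(α : ℝ) * form ![ξ 0, ξ 1] x| ≤ 2 * H * H * δ := by
      rw [abs_mul]; exact mul_le_mul hαle hxδ (abs_nonneg _) (by positivity)
    have t3 : |(β : ℝ) * form ![ξ 0, ξ 1] y| ≤ 2 * H * H * δ := by
      rw [abs_mul]; exact mul_le_mul hβle hyδ (abs_nonneg _) (by positivity)
    have u1 := abs_sub ((minor x y : ℝ) * form ξ b - α * form ![ξ 0, ξ 1] x)
      (β * form ![ξ 0, ξ 1] y)
    have u2 := abs_sub ((minor x y : ℝ) * form ξ b) (α * form ![ξ 0, ξ 1] x)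
    nlinarith

/-- Vectors outside the three-dimensional lattice give worse approximations. -/
theorem eventually_form_lt {ξ : Fin (m + 2) → ℝ} {p : ℕ → Fin 3 → ℤ}
    (hη : TotallyIrrational ![ξ 0, ξ 1]) (hp : IsBestApproxSeq ![ξ 0, ξ 1] p)
    (hw : ((3 * m + 2 : ℕ) : ℝ≥0∞) < uniformExp ![ξ 0, ξ 1])
    (hω : ordinaryExp (fun i : Fin m => ξ i.succ.succ) ≤ m) :
    ∀ᶠ j in atTop, ∀ b : Fin (m + 3) → ℤ, hat (rest b) ≠ 0 → ‖hat b‖ < ‖hat (p (j + 1))‖ →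
      |form ![ξ 0, ξ 1] (p j)| < |form ξ b| := by
  have hw2 : 2 < uniformExp ![ξ 0, ξ 1] := by
    refine lt_of_le_of_lt ?_ hw
    exact_mod_cast (by omega : 2 ≤ 3 * m + 2)
  obtain ⟨T, hT0, hmT, hTw⟩ := ENNReal.lt_iff_exists_real_btwn.1 hw
  rw [← ENNReal.ofReal_natCast, ENNReal.ofReal_lt_ofReal_iff_of_nonneg (by positivity)] at hmT
  push_cast at hmT
  -- The midpoint of `m` and `(T - 2) / 3`; the interval is non-empty because `T > 3 * m + 2`.
  set s : ℝ := (m + (T - 2) / 3) / 2 with hs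
  have hms : (m : ℝ) < s := by rw [hs]; linarith
  have hsT : 3 * s + 2 < T := by rw [hs]; linarith
  have hs0 : 0 < s := lt_of_le_of_lt (Nat.cast_nonneg m) hms
  have hωs : ordinaryExp (fun i : Fin m => ξ i.succ.succ) < ENNReal.ofReal s := by
    refine lt_of_le_of_lt hω ?_
    rw [← ENNReal.ofReal_natCast]
    exact (ENNReal.ofReal_lt_ofReal_iff hs0).2 hms
  have hH := hp.tendsto.comp (tendsto_add_atTop_nat 1)
  have hcube : Tendsto (fun H : ℝ => 2 * H ^ 3) atTop atTop :=
    (tendsto_pow_atTop (by norm_num)).const_mul_atTop (by norm_num)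
  have hlow := hcube.eventually (eventually_le_form_of_ordinaryExp_lt hs0 hωs)
  have hbig : Tendsto (fun H : ℝ => H ^ (T - 2 - 3 * s)) atTop atTop :=
    tendsto_rpow_atTop (by linarith)
  filter_upwards [hp.eventually_form_le hTw, hp.eventually_minor_ne_zero hη hw2,
    hH.eventually hlow, hH.eventually (hbig.eventually_gt_atTop (6 * 2 ^ s)),
    hH.eventually_gt_atTop 0] with j hj hmin hl hb hpos b hbr hbH
  simp only [Function.comp_apply] at hl hb hpos
  by_contra! hle
  obtain ⟨c, hc0, hcH, hcf⟩ := exists_elimination ξ b hmin hbr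
    (hp.strictMono (Nat.lt_succ_self j)).le le_rfl hbH.le le_rfl (hp.form_succ_le j) hle
  have h1 := (hl c hc0 hcH).trans hcf
  set H := ‖hat (p (j + 1))‖
  have h2 : (2 * H ^ 3) ^ (-s) ≤ 6 * H ^ 2 * H ^ (-T) := h1.trans (by gcongr)
  rw [Real.mul_rpow (by norm_num) (by positivity), ← Real.rpow_natCast H 3, ← Real.rpow_mul hpos.le,
    Real.rpow_neg (by norm_num), mul_assoc, ← Real.rpow_natCast H 2, ← Real.rpow_add hpos] at h2
  have h3 : H ^ (T - 2 - 3 * s) = H ^ (((3 : ℕ) : ℝ) * -s) / H ^ (((2 : ℕ) : ℝ) + -T) := by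
    rw [← Real.rpow_sub hpos]
    congr 1
    push_cast
    ring
  have h4 : (0 : ℝ) < 2 ^ s := by positivity
  have h5 : 0 < H ^ (((2 : ℕ) : ℝ) + -T) := Real.rpow_pos_of_pos hpos _
  rw [h3, lt_div_iff₀ h5] at hb
  rw [inv_mul_le_iff₀ h4] at h2
  linarith

end Extension

/-! ### Consequences of domination -/

section Main

variable {m : ℕ} {ξ : Fin (m + 2) → ℝ} {p : ℕ → Fin 3 → ℤ}

lemma emb_mem_lattice3 (x : Fin 3 → ℤ) : emb m x ∈ lattice3 (m + 2) := by
  have e : emb m x = x 0 • Pi.single 0 1 + x 1 • Pi.single 1 1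
      + x 2 • Pi.single (Fin.last (m + 2)) 1 := by
    ext i
    simp only [Pi.add_apply, Pi.smul_apply, Pi.single_apply, smul_eq_mul]
    refine Fin.cases ?_ (fun i => Fin.cases ?_ (fun i => ?_) i) i
    · simp [Fin.ext_iff]
    · simp [emb, Fin.ext_iff]
    · refine Fin.lastCases ?_ (fun i => ?_) i
      · simp [emb, Fin.ext_iff, -Fin.succ_last]
      · simp [emb, Fin.ext_iff, i.isLt.ne]
  rw [e]
  refine add_mem (add_mem ?_ ?_) ?_ <;>
    exact Submodule.smul_mem _ _ (Submodule.subset_span (by simp))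

lemma finrank_lattice3_le : Module.finrank ℤ (lattice3 (m + 2)) ≤ 3 := by
  have h := finrank_range_le_card (R := ℤ)
    (![Pi.single 0 1, Pi.single 1 1, Pi.single (Fin.last (m + 2)) 1] : Fin 3 → Fin (m + 3) → ℤ)
  rw [Fintype.card_fin] at h
  refine le_trans (le_of_eq ?_) h
  have e : Set.range
      (![Pi.single 0 1, Pi.single 1 1, Pi.single (Fin.last (m + 2)) 1] : Fin 3 → Fin (m + 3) → ℤ) =
      {Pi.single 0 1, Pi.single 1 1, Pi.single (Fin.last (m + 2)) 1} := by
    ext z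
    simp only [Matrix.range_cons, Matrix.range_empty, Set.union_empty, Set.mem_union,
      Set.mem_insert_iff, Set.mem_singleton_iff]
  rw [e]
  rfl

/-- If a sublattice contains the images of three vectors of non-zero determinant, its rank is at
least three. -/
lemma three_le_finrank {L : Submodule ℤ (Fin (m + 3) → ℤ)} {x y z : Fin 3 → ℤ}
    (hx : emb m x ∈ L) (hy : emb m y ∈ L) (hz : emb m z ∈ L)
    (hdet : Matrix.det !![x 0, x 1, x 2; y 0, y 1, y 2; z 0, z 1, z 2] ≠ 0) :
    3 ≤ Module.finrank ℤ L := by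
  have hli : LinearIndependent ℤ ![x, y, z] := by
    have e : (fun i => !![x 0, x 1, x 2; y 0, y 1, y 2; z 0, z 1, z 2] i) = ![x, y, z] := by
      ext i j
      fin_cases i <;> fin_cases j <;> rfl
    have h := Matrix.linearIndependent_rows_of_det_ne_zero hdet
    rwa [e] at h
  have hli' := hli.map' (emb m) (LinearMap.ker_eq_bot.2 emb_injective)
  have hmem : ∀ i, (emb m ∘ ![x, y, z]) i ∈ L := by
    intro i
    fin_cases i
    · exact hx
    · exact hy
    · exact hz
  have hL : LinearIndependent ℤ (fun i => (⟨_, hmem i⟩ : L)) :=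
    LinearIndependent.of_comp L.subtype hli'
  simpa using hL.fintype_card_le_finrank

/-- From `j₀` on, vectors outside the image of `ℤ³` approximate strictly worse than `p j`. -/
def Dominates (ξ : Fin (m + 2) → ℝ) (p : ℕ → Fin 3 → ℤ) (j₀ : ℕ) : Prop :=
  ∀ j ≥ j₀, ∀ b : Fin (m + 3) → ℤ, hat (rest b) ≠ 0 → ‖hat b‖ < ‖hat (p (j + 1))‖ →
    |form ![ξ 0, ξ 1] (p j)| < |form ξ b|

namespace Dominates

variable {j₀ : ℕ}

lemma totallyIrrational (h : Dominates ξ p j₀) (hη : TotallyIrrational ![ξ 0, ξ 1])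
    (hp : IsBestApproxSeq ![ξ 0, ξ 1] p) : TotallyIrrational ξ := by
  intro b hb hf
  by_cases hr : hat (rest b) = 0
  · rw [← emb_eq_of_hat_rest hr] at hb hf
    rw [form_emb] at hf
    exact hη _ (fun h0 => hb (by rw [h0, map_zero])) hf
  · obtain ⟨j, hj, hjb⟩ := ((hp.tendsto.comp (tendsto_add_atTop_nat 1)).eventually_gt_atTop
      ‖hat b‖ |>.and (eventually_ge_atTop j₀)).exists
    have := h j hjb b hr hj
    rw [hf, abs_zero] at this
    exact absurd this (not_lt.2 (abs_nonneg _))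

lemma isBestApprox_emb (h : Dominates ξ p j₀) (hp : IsBestApproxSeq ![ξ 0, ξ 1] p) {j : ℕ}
    (hj : j₀ ≤ j) : IsBestApprox ξ (emb m (p j)) := by
  refine ⟨by rw [norm_hat_emb]; exact (hp.isBest j).1, fun b hb hbj => ?_⟩
  rw [norm_hat_emb] at hbj
  rw [form_emb]
  by_cases hr : hat (rest b) = 0
  · rw [← emb_eq_of_hat_rest hr] at hb hbj ⊢
    rw [norm_hat_emb] at hb hbj
    rw [form_emb]
    exact (hp.isBest j).2 _ hb hbj
  · exact (h j hj b hr (lt_of_le_of_lt hbj (hp.strictMono (Nat.lt_succ_self j)))).le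

/-- A best approximation outside the lattice would have norm between those of some `p j` and `p (j +
1)`, where `p j` does strictly better. -/
lemma mem_lattice3 (h : Dominates ξ p j₀) (hp : IsBestApproxSeq ![ξ 0, ξ 1] p)
    {b : Fin (m + 3) → ℤ} (hb : IsBestApprox ξ b) (hbj : ‖hat (p j₀)‖ ≤ ‖hat b‖) :
    b ∈ lattice3 (m + 2) := by
  by_cases hr : hat (rest b) = 0
  · rw [← emb_eq_of_hat_rest hr]
    exact emb_mem_lattice3 _
  · obtain ⟨j, hj, hjb, hbj'⟩ := hp.exists_between hbj
    have h1 := hb.2 (emb m (p j)) (by rw [norm_hat_emb]; exact (hp.isBest j).1)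
      (by rwa [norm_hat_emb])
    rw [form_emb] at h1
    exact absurd (h j hj b hr hbj') (not_lt.2 h1)

lemma tailLiesIn (h : Dominates ξ p j₀) (hη : TotallyIrrational ![ξ 0, ξ 1])
    (hp : IsBestApproxSeq ![ξ 0, ξ 1] p) : TailLiesIn ξ (lattice3 (m + 2)) := by
  obtain ⟨q, hq⟩ := exists_isBestApproxSeq (h.totallyIrrational hη hp)
  obtain ⟨k, hk⟩ := eventually_atTop.1 (hq.tendsto.eventually_ge_atTop ‖hat (p j₀)‖)
  exact ⟨q, hq, k, fun j hj => h.mem_lattice3 hp (hq.isBest j) (hk j hj)⟩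

/-- Late `emb m (p j)` are themselves best approximations for `ξ`, so up to sign they belong to the
tail contained in `L`; three of them are independent. -/
lemma three_le_of_tailLiesIn (h : Dominates ξ p j₀) (hη : TotallyIrrational ![ξ 0, ξ 1])
    (hp : IsBestApproxSeq ![ξ 0, ξ 1] p) (hw : 2 < uniformExp ![ξ 0, ξ 1])
    {L : Submodule ℤ (Fin (m + 3) → ℤ)} (hL : TailLiesIn ξ L) : 3 ≤ Module.finrank ℤ L := by
  obtain ⟨q, hq, k, hk⟩ := hL
  obtain ⟨a, ha, haj⟩ := ((hp.tendsto.eventually_ge_atTop ‖hat (q k)‖).and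
    (eventually_ge_atTop j₀)).exists
  have hmem : ∀ j ≥ a, emb m (p j) ∈ L := by
    intro j hj
    obtain ⟨i, hi⟩ := hq.exhaustive _ (h.isBestApprox_emb hp (haj.trans hj))
    have hn : ‖hat (q i)‖ = ‖hat (p j)‖ := by
      rw [← norm_hat_emb (m := m)]
      rcases hi with hi | hi <;> rw [hi]
      rw [hat_neg, norm_neg]
    have hki : k ≤ i := hq.strictMono.le_iff_le.1 (by
      show ‖hat (q k)‖ ≤ ‖hat (q i)‖
      rw [hn]
      exact ha.trans (hp.strictMono.monotone hj))
    rcases hi with hi | hi <;> rw [hi]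
    · exact hk i hki
    · exact neg_mem (hk i hki)
  obtain ⟨j, hj, hdet⟩ := hp.exists_det_ne_zero hη hw a
  exact three_le_finrank (hmem a le_rfl) (hmem j hj) (hmem (j + 1) (hj.trans (Nat.le_succ j))) hdet

lemma R_eq_three (h : Dominates ξ p j₀) (hη : TotallyIrrational ![ξ 0, ξ 1])
    (hp : IsBestApproxSeq ![ξ 0, ξ 1] p) (hw : 2 < uniformExp ![ξ 0, ξ 1]) : R ξ = 3 := by
  have ht := h.tailLiesIn hη hp
  apply le_antisymm
  · have : R ξ ≤ Module.finrank ℤ (lattice3 (m + 2)) := Nat.sInf_le ⟨_, rfl, ht⟩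
    exact this.trans finrank_lattice3_le
  · refine le_csInf ⟨_, lattice3 (m + 2), rfl, ht⟩ ?_
    rintro r ⟨L, rfl, hL⟩
    exact h.three_le_of_tailLiesIn hη hp hw hL

/-- Embedded vectors keep norm and form, and any other vector of norm at most `Q` is beaten by the
last `p j` of norm at most `Q`. -/
lemma minForm_eventuallyEq (h : Dominates ξ p j₀) (hp : IsBestApproxSeq ![ξ 0, ξ 1] p) :
    minForm ξ =ᶠ[atTop] minForm ![ξ 0, ξ 1] := by
  filter_upwards [eventually_ge_atTop ‖hat (p j₀)‖] with Q hQ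
  apply le_antisymm
  · refine le_iInf₂ fun x hx => ?_
    rw [← form_emb]
    rw [← norm_hat_emb (m := m)] at hx
    exact minForm_le ξ hx.1 hx.2
  · refine le_iInf₂ fun b hb => ?_
    by_cases hr : hat (rest b) = 0
    · rw [← emb_eq_of_hat_rest hr] at hb ⊢
      rw [norm_hat_emb] at hb
      rw [form_emb]
      exact minForm_le _ hb.1 hb.2
    · obtain ⟨j, hj, hjQ, hQj⟩ := hp.exists_between hQ
      refine (minForm_le _ (hp.isBest j).1 hjQ).trans ?_
      exact ENNReal.ofReal_le_ofReal (h j hj b hr (lt_of_le_of_lt hb.2 hQj)).le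

end Dominates

lemma firstTwo_eq (hn : 2 ≤ m + 2) (ξ : Fin (m + 2) → ℝ) : firstTwo hn ξ = ![ξ 0, ξ 1] := by
  ext i
  fin_cases i <;> rfl

theorem exists_dominates {hn : 2 ≤ m + 2} (hξ : ξ ∈ scrT hn) :
    TotallyIrrational ![ξ 0, ξ 1] ∧ 2 < uniformExp ![ξ 0, ξ 1] ∧
      ∃ p j₀, IsBestApproxSeq ![ξ 0, ξ 1] p ∧ Dominates ξ p j₀ := by
  obtain ⟨⟨hη, hw⟩, hω⟩ := hξ
  rw [firstTwo_eq] at hη hw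
  have hw' : ((3 * m + 2 : ℕ) : ℝ≥0∞) < uniformExp ![ξ 0, ξ 1] := by
    rwa [show 3 * (m + 2) - 4 = 3 * m + 2 by omega] at hw
  -- `others` is this shifted tuple definitionally, since `m + 2 - 2` reduces to `m`.
  have hω' : ordinaryExp (fun i : Fin m => ξ i.succ.succ) ≤ m := le_of_eq hω
  obtain ⟨p, hp⟩ := exists_isBestApproxSeq hη
  obtain ⟨j₀, hj₀⟩ := eventually_atTop.1 (eventually_form_lt hη hp hw' hω')
  refine ⟨hη, lt_of_le_of_lt ?_ hw', p, j₀, hp, hj₀⟩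
  exact_mod_cast (by omega : 2 ≤ 3 * m + 2)

end Main

end LinForm

theorem mainTheorem4 (n : ℕ) (hn : 2 ≤ n) :
    (∀ ξ ∈ LinForm.scrT hn, LinForm.TailLiesIn ξ (LinForm.lattice3 n)) ∧
    LinForm.scrT hn ⊆ LinForm.Gam n ∧
    (∀ ξ ∈ LinForm.scrT hn,
      LinForm.uniformExp ξ = LinForm.uniformExp (LinForm.firstTwo hn ξ) ∧
      LinForm.ordinaryExp ξ = LinForm.ordinaryExp (LinForm.firstTwo hn ξ)) := by
  obtain ⟨m, rfl⟩ : ∃ m, n = m + 2 := ⟨n - 2, by omega⟩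
  refine ⟨fun ξ hξ => ?_, fun ξ hξ => ?_, fun ξ hξ => ?_⟩ <;>
    obtain ⟨hη, hw, p, j₀, hp, h⟩ := LinForm.exists_dominates hξ
  · exact h.tailLiesIn hη hp
  · exact ⟨h.totallyIrrational hη hp, h.R_eq_three hη hp hw⟩
  · rw [LinForm.firstTwo_eq]
    exact ⟨LinForm.uniformExp_congr (h.minForm_eventuallyEq hp),
      LinForm.ordinaryExp_congr (h.minForm_eventuallyEq hp)⟩
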